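/- Let $n,N,k\ge 1$ be integers, let $\Omega\subset\mathbb R^n$ be open and bounded, and suppose that $\Omega$ is a $W^{1,1}$-extension domain, i.e. there is a bounded linear operator $T\colon W^{1,1}(\Omega)\to W^{1,1}(\mathbb R^n)$ with $Tw=w$ a.e. in $\Omega$. Let $\mathbb M=\mathbb R^N\otimes\odot^k\mathbb R^n$ with the Euclidean inner product $\langle\xi,\eta\rangle=\sum_{i,j_1,\dots,j_k}\xi_{i,j_1\dots j_k}\eta_{i,j_1\dots j_k}$ and norm $|\xi|=\langle\xi,\xi\rangle^{1/2}$. Let $F\colon\mathbb M\to\mathbb R\cup\{+\infty\}$ be convex, lower semicontinuous, proper and essentially smooth, the last meaning that $C=\{\xi: F(\xi)<\infty\}$ is nonempty and open, $F$ is continuously differentiable on $C$, and $|F'(\xi_i)|\to\infty$ whenever $(\xi_i)\subset C$ converges to a boundary point of $C$. Suppose further that $F(\xi)\ge\theta(|\xi|)$ for all $\xi\in\mathbb M$, where $\theta\colon[0,\infty)\to[0,\infty)$ is increasing and convex with $\theta(t)/t\to\infty$ as $t\to\infty$. Let $W^{k,1}_0(\Omega,\mathbb R^N)$ be the closure of $C_c^\infty(\Omega,\mathbb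 R^N)$ in $W^{k,1}(\Omega,\mathbb R^N)$, and for $g\in W^{k,1}(\Omega,\mathbb R^N)$ put $W^{k,1}_g(\Omega,\mathbb R^N)=g+W^{k,1}_0(\Omega,\mathbb R^N)$. Let $\psi\in W^{k,1}(\Omega,\mathbb R^N)$ satisfy $F(\nabla^k\psi)\in L^1(\Omega)$ and $F(-\nabla^k\psi)\in L^1(\Omega)$, and let $$K=\{w\in L^1(\Omega,\mathbb R^N): w\ge\psi\text{ a.e. in }\Omega\},$$ where $\ge$ is understood componentwise. Let $g\in W^{k,1}(\Omega,\mathbb R^N)\cap K$ satisfy $F(s\nabla^k g)\in L^1(\Omega)$ for some $s>1$. Let $u\in W^{k,1}_g(\Omega,\mathbb R^N)\cap K$ be a minimiser, i.e. $F(\nabla^k u)\in L^1(\Omega)$ and $\int_\Omega F(\nabla^k u)\,dx\le\int_\Omega F(\nabla^k w)\,dx$ for all $w\in W^{k,1}_g(\Omega,\mathbb R^N)\cap K$. Then for every $v\in W^{k,1}_g(\Omega,\mathbb R^N)\cap K$ with $F(\nabla^k v)\in L^1(\Omega)$ and $F(-\nabla^k v)\in L^1(\Omega)$, $$\langle F'(\nabla^k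 u),\nabla^k(v-u)\rangle\in L^1(\Omega)\qquad\text{and}\qquad\int_\Omega\langle F'(\nabla^k u),\nabla^k(v-u)\rangle\,dx\ge 0 .$$ -/

import Mathlib

open MeasureTheory Set Filter Topology
open scoped ENNReal NNReal ContDiff

noncomputable section

/-- Euclidean space `ℝⁿ`. -/
abbrev Euc (n : ℕ) : Type := EuclideanSpace ℝ (Fin n)

/-- The space `ℝᴺ ⊗ ⊙ᵏ ℝⁿ`, realised as the arrays `ξ (i, (j₁, …, jₖ))` with `i ≤ N` and
`j₁, …, jₖ ≤ n` that are symmetric in `(j₁, …, jₖ)`. As a subspace of a Euclidean space it carries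
the inner product `⟪ξ, η⟫ = ∑ ξ (i, J) * η (i, J)` and the corresponding norm. -/
def symTensors (N k n : ℕ) : Submodule ℝ (EuclideanSpace ℝ (Fin N × (Fin k → Fin n))) where
  carrier := {ξ | ∀ (i : Fin N) (J : Fin k → Fin n) (τ : Equiv.Perm (Fin k)),
    ξ (i, J ∘ τ) = ξ (i, J)}
  add_mem' := by
    intro ξ η hξ hη i J τ
    simp only [PiLp.add_apply, hξ i J τ, hη i J τ]
  zero_mem' := by
    intro i J τ
    simp
  smul_mem' := by
    intro c ξ hξ i J τ
    simp only [PiLp.smul_apply, hξ i J τ]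

/-- The space `𝕄 = ℝᴺ ⊗ ⊙ᵏ ℝⁿ` as a type. -/
abbrev SymTensor (N k n : ℕ) : Type := symTensors N k n

/-! ### Sobolev spaces on an open set -/

/-- Smooth maps with compact support contained in `Ω`. -/
def IsTestMap {n : ℕ} {X : Type*} [NormedAddCommGroup X] [NormedSpace ℝ X]
    (Ω : Set (Euc n)) (φ : Euc n → X) : Prop :=
  ContDiff ℝ ∞ φ ∧ HasCompactSupport φ ∧ tsupport φ ⊆ Ω

/-- The iterated partial derivative `∂_{J₁} ⋯ ∂_{Jⱼ} φ`. -/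
def iterPartial {n j : ℕ} (J : Fin j → Fin n) (φ : Euc n → ℝ) (x : Euc n) : ℝ :=
  iteratedFDeriv ℝ j φ x (fun l => EuclideanSpace.single (J l) (1 : ℝ))

/-- `G` is the weak gradient of order `j` of `u : Ω → ℝᴺ`: both are locally integrable in `Ω` and
`∫_Ω (∂_J φ) uᵢ = (-1)ʲ ∫_Ω φ G_{i,J}` for all test functions `φ` and all `i`, `J`. -/
def HasWeakGrad {n N : ℕ} (Ω : Set (Euc n)) (j : ℕ) (u : Euc n → Euc N)
    (G : Euc n → SymTensor N j n) : Prop :=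
  LocallyIntegrableOn u Ω ∧ LocallyIntegrableOn G Ω ∧
    ∀ φ : Euc n → ℝ, IsTestMap Ω φ → ∀ (i : Fin N) (J : Fin j → Fin n),
      ∫ x in Ω, iterPartial J φ x * u x i =
        (-1 : ℝ) ^ j * ∫ x in Ω, φ x * (G x).1 (i, J)

open Classical in
/-- The weak gradient `∇ʲ u` on `Ω` (unique up to null sets in the open set `Ω`; the value is `0`
if there is no weak gradient of order `j`). -/
def weakGrad {n N : ℕ} (Ω : Set (Euc n)) (j : ℕ) (u : Euc n → Euc N) :
    Euc n → SymTensor N j n :=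
  if h : ∃ G, HasWeakGrad Ω j u G then h.choose else 0

/-- `u ∈ W^{k,1}(Ω, ℝᴺ)`. -/
def MemSobolev {n N : ℕ} (Ω : Set (Euc n)) (k : ℕ) (u : Euc n → Euc N) : Prop :=
  IntegrableOn u Ω ∧
    ∀ j ≤ k, ∃ G : Euc n → SymTensor N j n, HasWeakGrad Ω j u G ∧ IntegrableOn G Ω

/-- The `W^{k,1}(Ω, ℝᴺ)`-norm `∑_{j ≤ k} ∫_Ω |∇ʲ u|` (to be used for `u ∈ W^{k,1}(Ω, ℝᴺ)`). -/
def sobolevNorm {n N : ℕ} (Ω : Set (Euc n)) (k : ℕ) (u : Euc n → Euc N) : ℝ≥0∞ :=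
  ∑ j ∈ Finset.range (k + 1), ∫⁻ x in Ω, ‖weakGrad Ω j u x‖ₑ

/-- `u ∈ W^{k,1}_0(Ω, ℝᴺ)`, the closure of `C_c^∞(Ω, ℝᴺ)` in `W^{k,1}(Ω, ℝᴺ)`. -/
def MemSobolevZero {n N : ℕ} (Ω : Set (Euc n)) (k : ℕ) (u : Euc n → Euc N) : Prop :=
  MemSobolev Ω k u ∧
    ∀ ε : ℝ≥0∞, 0 < ε → ∃ φ : Euc n → Euc N, IsTestMap Ω φ ∧ sobolevNorm Ω k (u - φ) < ε

/-- The Dirichlet class `W^{k,1}_g(Ω, ℝᴺ) = g + W^{k,1}_0(Ω, ℝᴺ)`. -/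
def dirichletClass {n N : ℕ} (Ω : Set (Euc n)) (k : ℕ) (g : Euc n → Euc N) :
    Set (Euc n → Euc N) :=
  {u | MemSobolev Ω k u ∧ MemSobolevZero Ω k (u - g)}

/-- `Ω` is a `W^{1,1}`-extension domain: there is a bounded linear extension operator
`T : W^{1,1}(Ω) → W^{1,1}(ℝⁿ)`. (Linearity is required almost everywhere, since elements of
Sobolev spaces are represented by functions.) -/
def IsW11ExtensionDomain {n : ℕ} (Ω : Set (Euc n)) : Prop :=
  ∃ (T : (Euc n → Euc 1) → (Euc n → Euc 1)) (C : ℝ≥0),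
    (∀ u, MemSobolev Ω 1 u →
      MemSobolev univ 1 (T u) ∧ T u =ᵐ[volume.restrict Ω] u ∧
        sobolevNorm univ 1 (T u) ≤ C * sobolevNorm Ω 1 u) ∧
    (∀ u v, MemSobolev Ω 1 u → MemSobolev Ω 1 v → ∀ a b : ℝ,
      T (a • u + b • v) =ᵐ[volume] a • T u + b • T v)

/-! ### Extended real-valued integrands -/

section Integrands

variable {M : Type*} [NormedAddCommGroup M] [InnerProductSpace ℝ M]

/-- The (effective) domain of `F`. -/
def effDom (F : M → EReal) : Set M := {ξ | F ξ < ⊤}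

/-- Convexity of an extended real-valued function that does not take the value `-∞`. -/
def IsConvexIntegrand (F : M → EReal) : Prop :=
  ∀ (ξ η : M) (a b : ℝ), 0 ≤ a → 0 ≤ b → a + b = 1 →
    F (a • ξ + b • η) ≤ (a : EReal) * F ξ + (b : EReal) * F η

/-- `F` takes values in `ℝ ∪ {+∞}` and is finite somewhere. -/
def IsProperIntegrand (F : M → EReal) : Prop :=
  (∀ ξ, F ξ ≠ ⊥) ∧ (effDom F).Nonempty

/-- The gradient `F'(ξ)` with respect to the inner product of `M`; meaningful at interior points of
the domain of `F`. -/
def gradF [CompleteSpace M] (F : M → EReal) (ξ : M) : M :=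
  gradient (fun ζ => (F ζ).toReal) ξ

/-- Essential smoothness: the domain is nonempty and open, `F` is `C¹` on it, and `|F'|` tends to
infinity along every sequence in the domain that converges to a boundary point of the domain. -/
def IsEssentiallySmooth [CompleteSpace M] (F : M → EReal) : Prop :=
  (effDom F).Nonempty ∧ IsOpen (effDom F) ∧
    ContDiffOn ℝ 1 (fun ζ => (F ζ).toReal) (effDom F) ∧
    ∀ (x : ℕ → M) (y : M), (∀ i, x i ∈ effDom F) → y ∈ frontier (effDom F) →
      Tendsto x atTop (𝓝 y) → Tendsto (fun i => ‖gradF F (x i)‖) atTop atTop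

/-- The superlinear lower bound: `F ξ ≥ θ |ξ|` with `θ : [0,∞) → [0,∞)` increasing, convex and
`θ t / t → ∞` as `t → ∞`. -/
def HasSuperlinearBound (F : M → EReal) : Prop :=
  ∃ θ : ℝ → ℝ, (∀ t, 0 ≤ t → 0 ≤ θ t) ∧ MonotoneOn θ (Ici 0) ∧ ConvexOn ℝ (Ici 0) θ ∧
    Tendsto (fun t => θ t / t) atTop atTop ∧ ∀ ξ, (θ ‖ξ‖ : EReal) ≤ F ξ

end Integrands

/-- An extended real-valued function belongs to `L¹(Ω)`: it is finite almost everywhere in `Ω`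
and integrable over `Ω`. -/
def InL1 {n : ℕ} (Ω : Set (Euc n)) (h : Euc n → EReal) : Prop :=
  (∀ᵐ x ∂(volume.restrict Ω), h x ≠ ⊤ ∧ h x ≠ ⊥) ∧ IntegrableOn (fun x => (h x).toReal) Ω

/-- The energy `∫_Ω F(∇ᵏ v) dx ∈ [0, ∞]` of a nonnegative integrand `F`. -/
def energy {n N : ℕ} (Ω : Set (Euc n)) (k : ℕ) (F : SymTensor N k n → EReal)
    (v : Euc n → Euc N) : ℝ≥0∞ :=
  ∫⁻ x in Ω, (F (weakGrad Ω k v x)).toENNReal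

/-- `u ∈ W^{k,1}_g(Ω, ℝᴺ) ∩ K` is a minimiser, for a nonnegative integrand `F`:
`F(∇ᵏ u) ∈ L¹(Ω)` and `u` has least energy in `W^{k,1}_g(Ω, ℝᴺ) ∩ K`. -/
def IsMinimiser {n N : ℕ} (Ω : Set (Euc n)) (k : ℕ) (F : SymTensor N k n → EReal)
    (g : Euc n → Euc N) (K : Set (Euc n → Euc N)) (u : Euc n → Euc N) : Prop :=
  u ∈ dirichletClass Ω k g ∩ K ∧ InL1 Ω (fun x => F (weakGrad Ω k u x)) ∧
    ∀ v ∈ dirichletClass Ω k g ∩ K, energy Ω k F u ≤ energy Ω k F v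

/-- The obstacle set `{u ∈ L¹(Ω, ℝᴺ) : u ≥ ψ a.e. in Ω}`, with `≥` understood componentwise. -/
def obstacleSet {n N : ℕ} (Ω : Set (Euc n)) (ψ : Euc n → Euc N) : Set (Euc n → Euc N) :=
  {u | IntegrableOn u Ω ∧ ∀ᵐ x ∂(volume.restrict Ω), ∀ i, ψ x i ≤ u x i}

end

/-! ### Test functions and iterated partial derivatives -/

/-! The admissible class is convex, so a minimiser `u` can be compared with `u + t(v - u)` for t =
1/(m+1). Write U = ∇ᵏu and V = ∇ᵏv. The quotients q_m = (F(U + t(V - U)) - F(U))/t have nonnegative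
integrals by minimality, and convexity of F gives q_m ≤ F(V) - F(U), which is integrable. Since F is
finite a.e. at U and C¹ on its open domain, q_m → ⟨F'(U), V - U⟩ a.e. Fatou's lemma applied to F(V)
- F(U) - q_m ≥ 0 bounds the limit on both sides: it is integrable, and its integral is nonnegative.
No growth condition on F' is needed.

The analytic core is `IsEssentiallySmooth.tendsto_quotient`,
`IsConvexIntegrand.finite_and_toReal_le` and `integrable_and_integral_nonneg_of_tendsto`. The rest
is calculus of weak gradients: linearity, a.e. uniqueness, and convexity of the Dirichlet class. The
last rests on test maps being Sobolev, hence on symmetry of classical derivatives and integration by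
parts. -/

lemma IsTestMap.linComb {n : ℕ} {X : Type*} [NormedAddCommGroup X] [NormedSpace ℝ X]
    {Ω : Set (Euc n)} {φ χ : Euc n → X} (hφ : IsTestMap Ω φ) (hχ : IsTestMap Ω χ) (a b : ℝ) :
    IsTestMap Ω (a • φ + b • χ) := by
  have h1 : tsupport (a • φ + b • χ) ⊆ tsupport φ ∪ tsupport χ := by
    refine (tsupport_add _ _).trans (union_subset_union ?_ ?_)
    · exact tsupport_smul_subset_right (fun _ => a) φ
    · exact tsupport_smul_subset_right (fun _ => b) χ
  exact ⟨(contDiff_const.smul hφ.1).add (contDiff_const.smul hχ.1),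
    (hφ.2.1.isCompact.union hχ.2.1.isCompact).of_isClosed_subset (isClosed_tsupport _) h1,
    h1.trans (union_subset hφ.2.2 hχ.2.2)⟩

lemma IsTestMap.coord {n N : ℕ} {Ω : Set (Euc n)} {φ : Euc n → Euc N} (hφ : IsTestMap Ω φ)
    (i : Fin N) : IsTestMap Ω (fun x => φ x i) := by
  have h : tsupport (fun x => φ x i) ⊆ tsupport φ :=
    tsupport_comp_subset (g := fun y : Euc N => y i) rfl φ
  exact ⟨(EuclideanSpace.proj (𝕜 := ℝ) i).contDiff.comp hφ.1,
    hφ.2.1.of_isClosed_subset (isClosed_tsupport _) h, h.trans hφ.2.2⟩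

lemma IsTestMap.fderiv_apply {n : ℕ} {Ω : Set (Euc n)} {φ : Euc n → ℝ} (hφ : IsTestMap Ω φ)
    (e : Euc n) : IsTestMap Ω (fun x => fderiv ℝ φ x e) :=
  ⟨(hφ.1.fderiv_right (m := ∞) (by simp)).clm_apply contDiff_const,
    hφ.2.1.fderiv_apply ℝ e, (tsupport_fderiv_apply_subset ℝ e).trans hφ.2.2⟩

lemma contDiff_iterPartial {n j : ℕ} {φ : Euc n → ℝ} (hφ : ContDiff ℝ ∞ φ)
    (J : Fin j → Fin n) : ContDiff ℝ ∞ (iterPartial J φ) :=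
  (ContinuousMultilinearMap.apply ℝ (fun _ : Fin j => Euc n) ℝ _).contDiff.comp
    (hφ.iteratedFDeriv_right (m := ∞) (i := j) (by exact_mod_cast le_top))

lemma IsTestMap.iteratedPartial {n j : ℕ} {Ω : Set (Euc n)} {φ : Euc n → ℝ} (hφ : IsTestMap Ω φ)
    (J : Fin j → Fin n) : IsTestMap Ω (iterPartial J φ) := by
  have h : tsupport (iterPartial J φ) ⊆ tsupport φ :=
    (tsupport_comp_subset (g := fun T : (Euc n) [×j]→L[ℝ] ℝ =>
      T (fun l => EuclideanSpace.single (J l) (1 : ℝ))) rfl (iteratedFDeriv ℝ j φ)).trans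
      (tsupport_iteratedFDeriv_subset j)
  exact ⟨contDiff_iterPartial hφ.1 J, hφ.2.1.of_isClosed_subset (isClosed_tsupport _) h,
    h.trans hφ.2.2⟩

lemma iterPartial_succ_left {n j : ℕ} {φ : Euc n → ℝ} (hφ : ContDiff ℝ ∞ φ)
    (J : Fin (j + 1) → Fin n) (x : Euc n) :
    iterPartial J φ x =
      fderiv ℝ (iterPartial (Fin.tail J) φ) x (EuclideanSpace.single (J 0) 1) := by
  have hd : DifferentiableAt ℝ (iteratedFDeriv ℝ j φ) x :=
    (hφ.differentiable_iteratedFDeriv (by exact_mod_cast WithTop.coe_lt_top _)) x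
  have := (((ContinuousMultilinearMap.apply ℝ (fun _ : Fin j => Euc n) ℝ
    (fun l => EuclideanSpace.single (Fin.tail J l) (1 : ℝ))).hasFDerivAt).comp x
      hd.hasFDerivAt).fderiv
  have h2 : iterPartial (Fin.tail J) φ = (ContinuousMultilinearMap.apply ℝ
    (fun _ : Fin j => Euc n) ℝ (fun l => EuclideanSpace.single (Fin.tail J l) (1 : ℝ))) ∘
      iteratedFDeriv ℝ j φ := rfl
  rw [h2, this, iterPartial, iteratedFDeriv_succ_apply_left]
  rfl

/-- A swap of the two outermost derivatives is the symmetry of a second derivative. For any other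
adjacent swap the outermost derivative is peeled off and the induction hypothesis applies inside. -/
lemma iterPartial_comp_swap {n j : ℕ} {φ : Euc n → ℝ} (hφ : ContDiff ℝ ∞ φ)
    (J : Fin (j + 1) → Fin n) (i : Fin j) (x : Euc n) :
    iterPartial (J ∘ Equiv.swap i.castSucc i.succ) φ x = iterPartial J φ x := by
  induction j generalizing x with
  | zero => exact i.elim0
  | succ j ih =>
    rw [iterPartial_succ_left hφ, iterPartial_succ_left hφ]
    refine Fin.cases ?_ (fun i' => ?_) i
    · set f := iterPartial (Fin.tail (Fin.tail J)) φ with hf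
      have hfs : ContDiff ℝ ∞ f := contDiff_iterPartial hφ _
      have hd : DifferentiableAt ℝ (fderiv ℝ f) x :=
        (hfs.fderiv_right (m := ∞) (by simp)).differentiable (by simp) x
      have h1 : Fin.tail (Fin.tail (J ∘ Equiv.swap (Fin.castSucc (0 : Fin (j + 1)))
          (Fin.succ 0))) = Fin.tail (Fin.tail J) := by
        funext l
        simp only [Fin.tail, Function.comp_apply]
        rw [Equiv.swap_apply_of_ne_of_ne] <;> simp [Fin.ext_iff]
      have key : ∀ a b : Euc n, fderiv ℝ (fun y => fderiv ℝ f y a) x b =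
          fderiv ℝ (fderiv ℝ f) x b a := fun a b => by
        rw [fderiv_clm_apply hd (differentiableAt_const a)]
        simp
      have hsymm : IsSymmSndFDerivAt ℝ f x :=
        (contDiff_infty.1 hfs 2).contDiffAt.isSymmSndFDerivAt (by simp)
      rw [funext (iterPartial_succ_left hφ (Fin.tail J)),
        funext (iterPartial_succ_left hφ (Fin.tail (J ∘ _))), h1, ← hf, key, key, hsymm.eq]
      simp [Fin.tail]
    · have h1 : Fin.tail (J ∘ Equiv.swap i'.succ.castSucc i'.succ.succ) =
          Fin.tail J ∘ Equiv.swap i'.castSucc i'.succ := by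
        funext l
        simp only [Fin.tail, Function.comp_apply]
        rw [← Fin.succ_castSucc, ← (Fin.succ_injective _).map_swap]
      rw [h1, funext (fun y => ih (Fin.tail J) i' y)]
      congr 2

/-- Iterated partial derivatives of a smooth function commute. -/
lemma iterPartial_comp_perm {n j : ℕ} {φ : Euc n → ℝ} (hφ : ContDiff ℝ ∞ φ)
    (J : Fin j → Fin n) (τ : Equiv.Perm (Fin j)) (x : Euc n) :
    iterPartial (J ∘ τ) φ x = iterPartial J φ x := by
  cases j with
  | zero => rw [Subsingleton.elim (J ∘ τ) J]
  | succ j =>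
    -- Adjacent transpositions generate the symmetric group, already as a monoid.
    have hτ : τ ∈ Submonoid.closure
        (range fun i : Fin j => Equiv.swap i.castSucc i.succ) := by
      rw [Equiv.Perm.mclosure_swap_castSucc_succ]
      trivial
    induction hτ using Submonoid.closure_induction generalizing J with
    | mem τ h =>
      obtain ⟨i, rfl⟩ := h
      exact iterPartial_comp_swap hφ J i x
    | one => rfl
    | mul σ τ _ _ h1 h2 => exact (h2 (J ∘ σ)).trans (h1 J)

/-- A cyclic rotation moves `J 0` from the outermost to the innermost place, which is harmless
because the derivatives commute. -/
lemma iterPartial_succ_right {n j : ℕ} {φ : Euc n → ℝ} (hφ : ContDiff ℝ ∞ φ)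
    (J : Fin (j + 1) → Fin n) (x : Euc n) :
    iterPartial J φ x =
      iterPartial (Fin.tail J) (fun y => fderiv ℝ φ y (EuclideanSpace.single (J 0) 1)) x := by
  rw [← iterPartial_comp_perm hφ J (finRotate (j + 1)) x]
  have hJ : J ∘ finRotate (j + 1) = Fin.snoc (α := fun _ => Fin n) (Fin.tail J) (J 0) := by
    rw [Fin.snoc_eq_cons_rotate]
    funext i
    simp
  have hc : ContDiffAt ℝ j (fderiv ℝ φ) x :=
    (hφ.fderiv_right (m := j) (by exact_mod_cast le_top)).contDiffAt
  have := (ContinuousLinearMap.apply ℝ ℝ (EuclideanSpace.single (J 0) (1 : ℝ))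
    ).iteratedFDeriv_comp_left hc (i := j) le_rfl
  rw [iterPartial, iterPartial, iteratedFDeriv_succ_apply_right, hJ]
  have h2 : (fun y => fderiv ℝ φ y (EuclideanSpace.single (J 0) 1)) =
    ⇑(ContinuousLinearMap.apply ℝ ℝ (EuclideanSpace.single (J 0) (1 : ℝ))) ∘ fderiv ℝ φ := rfl
  rw [h2, this]
  simp only [ContinuousLinearMap.compContinuousMultilinearMap_coe, Function.comp_apply,
    ContinuousLinearMap.apply_apply, Fin.snoc_last]
  congr 2
  funext l
  simp [Fin.init]

/-- The product vanishes off the compact set `tsupport φ ⊆ Ω`, where `f` is integrable and `φ` is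
bounded. -/
lemma IsTestMap.integrable_mul {n : ℕ} {Ω : Set (Euc n)} {φ : Euc n → ℝ} (hφ : IsTestMap Ω φ)
    {f : Euc n → ℝ} (hf : LocallyIntegrableOn f Ω) :
    Integrable (fun x => φ x * f x) := by
  have h1 : IntegrableOn f (tsupport φ) := hf.integrableOn_compact_subset hφ.2.2 hφ.2.1.isCompact
  have h2 : IntegrableOn (fun x => φ x * f x) (tsupport φ) :=
    h1.continuousOn_mul hφ.1.continuous.continuousOn hφ.2.1.isCompact
  refine (integrableOn_iff_integrable_of_support_subset ?_).1 h2
  intro x hx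
  exact subset_tsupport _ (left_ne_zero_of_mul hx)

lemma IsTestMap.setIntegral_mul {n : ℕ} {Ω : Set (Euc n)} {φ : Euc n → ℝ} (hφ : IsTestMap Ω φ)
    (f : Euc n → ℝ) : ∫ x in Ω, φ x * f x = ∫ x, φ x * f x := by
  refine setIntegral_eq_integral_of_forall_compl_eq_zero fun x hx => ?_
  rw [image_eq_zero_of_notMem_tsupport (fun h => hx (hφ.2.2 h)), zero_mul]

/-- Integration by parts for iterated partial derivatives of test functions. -/
lemma integral_iterPartial_mul {n : ℕ} {Ω : Set (Euc n)} (j : ℕ) (J : Fin j → Fin n)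
    {φ χ : Euc n → ℝ} (hφ : IsTestMap Ω φ) (hχ : IsTestMap Ω χ) :
    ∫ x, iterPartial J φ x * χ x = (-1 : ℝ) ^ j * ∫ x, φ x * iterPartial J χ x := by
  induction j generalizing χ with
  | zero => simp [iterPartial]
  | succ j ih =>
    have hp := hφ.iteratedPartial (Fin.tail J)
    set e : Euc n := EuclideanSpace.single (J 0) 1
    have hχe := hχ.fderiv_apply e
    have hpe := hp.fderiv_apply e
    have loc : ∀ {f : Euc n → ℝ}, IsTestMap Ω f → LocallyIntegrableOn f Ω := fun h =>
      h.1.continuous.locallyIntegrable.locallyIntegrableOn _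
    -- This moves the outermost derivative from `φ` to `χ`; the remaining ones are moved by the
    -- induction hypothesis, applied to the derivative of `χ`.
    have h1 := integral_mul_fderiv_eq_neg_fderiv_mul_of_integrable (μ := (volume : Measure (Euc n)))
      (v := e) (hpe.integrable_mul (loc hχ)) (hp.integrable_mul (loc hχe))
      (hp.integrable_mul (loc hχ)) (fun x _ => hp.1.differentiable (by simp) x)
      (fun x _ => hχ.1.differentiable (by simp) x)
    simp only [iterPartial_succ_left hφ.1 J, iterPartial_succ_right hχ.1 J]
    rw [ih (Fin.tail J) hχe] at h1
    rw [← neg_eq_iff_eq_neg.2 h1, pow_succ]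
    ring

/-! ### Weak gradients -/

section WeakGradients

variable {n N j k : ℕ} {Ω : Set (Euc n)} {u v : Euc n → Euc N} {G H : Euc n → SymTensor N j n}

/-- Evaluation of a symmetric tensor at an index. -/
noncomputable def symTensorCoord (N j n : ℕ) (p : Fin N × (Fin j → Fin n)) :
    SymTensor N j n →L[ℝ] ℝ :=
  (EuclideanSpace.proj (𝕜 := ℝ) p).comp (symTensors N j n).subtypeL

lemma locallyIntegrableOn_coord (hu : LocallyIntegrableOn u Ω) (i : Fin N) :
    LocallyIntegrableOn (fun x => u x i) Ω :=
  (EuclideanSpace.proj (𝕜 := ℝ) i).locallyIntegrableOn_comp hu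

lemma locallyIntegrableOn_symTensorCoord (hG : LocallyIntegrableOn G Ω)
    (p : Fin N × (Fin j → Fin n)) : LocallyIntegrableOn (fun x => (G x).1 p) Ω :=
  (symTensorCoord N j n p).locallyIntegrableOn_comp hG

lemma HasWeakGrad.linComb (hu : HasWeakGrad Ω j u G) (hv : HasWeakGrad Ω j v H) (a b : ℝ) :
    HasWeakGrad Ω j (a • u + b • v) (a • G + b • H) := by
  refine ⟨(hu.1.smul a).add (hv.1.smul b), (hu.2.1.smul a).add (hv.2.1.smul b),
    fun φ hφ i J => ?_⟩
  have e1 : ∀ x, iterPartial J φ x * (a • u + b • v) x i =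
      a * (iterPartial J φ x * u x i) + b * (iterPartial J φ x * v x i) := fun x => by
    simp only [Pi.add_apply, Pi.smul_apply, PiLp.add_apply, PiLp.smul_apply, smul_eq_mul]
    ring
  have e2 : ∀ x, φ x * ((a • G + b • H) x).1 (i, J) =
      a * (φ x * (G x).1 (i, J)) + b * (φ x * (H x).1 (i, J)) := fun x => by
    simp only [Pi.add_apply, Pi.smul_apply, Submodule.coe_add, Submodule.coe_smul,
      PiLp.add_apply, PiLp.smul_apply, smul_eq_mul]
    ring
  have hJ := hφ.iteratedPartial J
  simp only [e1, e2]
  rw [integral_add, integral_add, integral_const_mul, integral_const_mul, integral_const_mul,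
    integral_const_mul, hu.2.2 φ hφ, hv.2.2 φ hφ]
  · ring
  · exact ((hφ.integrable_mul (locallyIntegrableOn_symTensorCoord hu.2.1 _)).const_mul a).restrict
  · exact ((hφ.integrable_mul (locallyIntegrableOn_symTensorCoord hv.2.1 _)).const_mul b).restrict
  · exact ((hJ.integrable_mul (locallyIntegrableOn_coord hu.1 i)).const_mul a).restrict
  · exact ((hJ.integrable_mul (locallyIntegrableOn_coord hv.1 i)).const_mul b).restrict

/-- The fundamental lemma of the calculus of variations, applied to each coordinate of the
difference. -/
lemma HasWeakGrad.unique (hΩ : IsOpen Ω) (hG : HasWeakGrad Ω j u G) (hH : HasWeakGrad Ω j u H) :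
    G =ᵐ[volume.restrict Ω] H := by
  have key : ∀ p : Fin N × (Fin j → Fin n),
      ∀ᵐ x ∂(volume : Measure (Euc n)), x ∈ Ω → (G x).1 p - (H x).1 p = 0 := by
    rintro ⟨i, J⟩
    have lG := locallyIntegrableOn_symTensorCoord hG.2.1 (i, J)
    have lH := locallyIntegrableOn_symTensorCoord hH.2.1 (i, J)
    refine hΩ.ae_eq_zero_of_integral_contDiff_smul_eq_zero (lG.sub lH) fun φ h1 h2 h3 => ?_
    have hφ : IsTestMap Ω φ := ⟨h1, h2, h3⟩
    have h := (hG.2.2 φ hφ i J).symm.trans (hH.2.2 φ hφ i J)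
    rw [hφ.setIntegral_mul, hφ.setIntegral_mul] at h
    have h' := mul_left_cancel₀ (pow_ne_zero j (by norm_num : (-1 : ℝ) ≠ 0)) h
    simp only [smul_eq_mul, mul_sub]
    rw [integral_sub (hφ.integrable_mul lG) (hφ.integrable_mul lH), h', sub_self]
  have h := ae_all_iff.2 key
  filter_upwards [ae_restrict_of_ae h, ae_restrict_mem hΩ.measurableSet] with x hx hxΩ
  apply Subtype.ext
  ext p
  exact sub_eq_zero.1 (hx p hxΩ)

lemma hasWeakGrad_weakGrad (h : ∃ G, HasWeakGrad Ω j u G) :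
    HasWeakGrad Ω j u (weakGrad Ω j u) := by
  rw [weakGrad, dif_pos h]
  exact h.choose_spec

lemma HasWeakGrad.weakGrad_ae_eq (hΩ : IsOpen Ω) (hG : HasWeakGrad Ω j u G) :
    weakGrad Ω j u =ᵐ[volume.restrict Ω] G :=
  (hasWeakGrad_weakGrad ⟨G, hG⟩).unique hΩ hG

lemma MemSobolev.hasWeakGrad (hu : MemSobolev Ω k u) (hj : j ≤ k) :
    HasWeakGrad Ω j u (weakGrad Ω j u) :=
  hasWeakGrad_weakGrad ((hu.2 j hj).imp fun _ h => h.1)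

lemma MemSobolev.integrableOn_weakGrad (hΩ : IsOpen Ω) (hu : MemSobolev Ω k u) (hj : j ≤ k) :
    IntegrableOn (weakGrad Ω j u) Ω := by
  obtain ⟨G, h1, h2⟩ := hu.2 j hj
  exact Integrable.congr h2 (h1.weakGrad_ae_eq hΩ).symm

lemma MemSobolev.linComb (hu : MemSobolev Ω k u) (hv : MemSobolev Ω k v) (a b : ℝ) :
    MemSobolev Ω k (a • u + b • v) := by
  refine ⟨(hu.1.smul a).add (hv.1.smul b), fun j hj => ?_⟩
  obtain ⟨G, hG, iG⟩ := hu.2 j hj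
  obtain ⟨H, hH, iH⟩ := hv.2 j hj
  exact ⟨_, hG.linComb hH a b, (iG.smul a).add (iH.smul b)⟩

lemma MemSobolev.weakGrad_linComb (hΩ : IsOpen Ω) (hu : MemSobolev Ω k u) (hv : MemSobolev Ω k v)
    (hj : j ≤ k) (a b : ℝ) :
    weakGrad Ω j (a • u + b • v) =ᵐ[volume.restrict Ω]
      a • weakGrad Ω j u + b • weakGrad Ω j v :=
  ((hu.hasWeakGrad hj).linComb (hv.hasWeakGrad hj) a b).weakGrad_ae_eq hΩ

/-- The classical gradient of order `j` of a smooth map. -/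
noncomputable def smoothGrad (j : ℕ) (φ : Euc n → Euc N) (hφ : ∀ i, ContDiff ℝ ∞ fun x => φ x i)
    (x : Euc n) : SymTensor N j n :=
  ⟨WithLp.toLp 2 fun p => iterPartial p.2 (fun y => φ y p.1) x,
    fun i J τ => iterPartial_comp_perm (hφ i) J τ x⟩

/-- Ensures that `u - φ` is Sobolev when `u` is, so that `sobolevNorm` of it is computed from
genuine weak gradients and not from the default value 0. -/
lemma IsTestMap.memSobolev {φ : Euc n → Euc N} (hφ : IsTestMap Ω φ) : MemSobolev Ω k φ := by
  have hφi : ∀ i, ContDiff ℝ ∞ fun x => φ x i := fun i => (hφ.coord i).1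
  have iφ : Integrable φ := hφ.1.continuous.integrable_of_hasCompactSupport hφ.2.1
  refine ⟨iφ.integrableOn, fun j _ => ⟨smoothGrad j φ hφi, ?_⟩⟩
  have hc : Continuous (smoothGrad j φ hφi) := by
    refine Continuous.subtype_mk ((PiLp.continuous_toLp 2 _).comp ?_) _
    exact continuous_pi fun p => (contDiff_iterPartial (hφi p.1) p.2).continuous
  have hs : HasCompactSupport (smoothGrad j φ hφi) := by
    refine HasCompactSupport.intro hφ.2.1 fun x hx => ?_
    apply Subtype.ext
    ext p
    change iterPartial p.2 (fun y => φ y p.1) x = 0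
    have h : iteratedFDeriv ℝ j (fun y => φ y p.1) x = 0 := by
      by_contra hne
      have h1 := support_iteratedFDeriv_subset (𝕜 := ℝ) j (Function.mem_support.2 hne)
      exact hx (tsupport_comp_subset (g := fun y : Euc N => y p.1) rfl φ h1)
    simp [iterPartial, h]
  have iG : Integrable (smoothGrad j φ hφi) := hc.integrable_of_hasCompactSupport hs
  refine ⟨⟨iφ.integrableOn.locallyIntegrableOn, iG.integrableOn.locallyIntegrableOn,
    fun χ hχ i J => ?_⟩, iG.integrableOn⟩
  rw [(hχ.iteratedPartial J).setIntegral_mul fun x => φ x i, hχ.setIntegral_mul]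
  exact integral_iterPartial_mul j J hχ (hφ.coord i)

/-! ### Convexity of the admissible class. -/

lemma sobolevNorm_linComb_le (hΩ : IsOpen Ω) (hu : MemSobolev Ω k u) (hv : MemSobolev Ω k v)
    (a b : ℝ) :
    sobolevNorm Ω k (a • u + b • v) ≤ ‖a‖ₑ * sobolevNorm Ω k u + ‖b‖ₑ * sobolevNorm Ω k v := by
  simp only [sobolevNorm, Finset.mul_sum, ← Finset.sum_add_distrib]
  refine Finset.sum_le_sum fun j hj => ?_
  have hjk : j ≤ k := Nat.lt_succ_iff.1 (Finset.mem_range.1 hj)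
  have mu := (hu.integrableOn_weakGrad hΩ hjk).aestronglyMeasurable.enorm
  have mv := (hv.integrableOn_weakGrad hΩ hjk).aestronglyMeasurable.enorm
  rw [← lintegral_const_mul'' _ mu, ← lintegral_const_mul'' _ mv,
    ← lintegral_add_left' (mu.const_mul _)]
  refine lintegral_mono_ae ?_
  filter_upwards [hu.weakGrad_linComb hΩ hv hjk a b] with x hx
  rw [hx, ← enorm_smul, ← enorm_smul]
  exact enorm_add_le _ _

lemma MemSobolevZero.convexComb (hΩ : IsOpen Ω) (hu : MemSobolevZero Ω k u)
    (hv : MemSobolevZero Ω k v) {a b : ℝ} (ha : 0 ≤ a) (hb : 0 ≤ b) (hab : a + b = 1) :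
    MemSobolevZero Ω k (a • u + b • v) := by
  refine ⟨hu.1.linComb hv.1 a b, fun ε hε => ?_⟩
  have hε2 : 0 < ε / 2 := ENNReal.half_pos hε.ne'
  obtain ⟨φ, hφ, h1⟩ := hu.2 (ε / 2) hε2
  obtain ⟨χ, hχ, h2⟩ := hv.2 (ε / 2) hε2
  have sub_mem : ∀ {w η : Euc n → Euc N}, MemSobolev Ω k w → IsTestMap Ω η →
      MemSobolev Ω k (w - η) := fun hw hη => by
    simpa [sub_eq_add_neg] using hw.linComb hη.memSobolev 1 (-1)
  have ha1 : ‖a‖ₑ ≤ 1 := by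
    rw [Real.enorm_eq_ofReal ha]
    exact ENNReal.ofReal_le_one.2 (by linarith)
  have hb1 : ‖b‖ₑ ≤ 1 := by
    rw [Real.enorm_eq_ofReal hb]
    exact ENNReal.ofReal_le_one.2 (by linarith)
  refine ⟨a • φ + b • χ, hφ.linComb hχ a b, ?_⟩
  have e : a • u + b • v - (a • φ + b • χ) = a • (u - φ) + b • (v - χ) := by
    simp only [smul_sub]
    abel
  rw [e]
  calc _ ≤ _ := sobolevNorm_linComb_le hΩ (sub_mem hu.1 hφ) (sub_mem hv.1 hχ) a b
    _ ≤ 1 * sobolevNorm Ω k (u - φ) + 1 * sobolevNorm Ω k (v - χ) := by gcongr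
    _ < ε / 2 + ε / 2 := by
      rw [one_mul, one_mul]
      exact ENNReal.add_lt_add h1 h2
    _ = ε := ENNReal.add_halves ε

lemma dirichletClass_convexComb (hΩ : IsOpen Ω) {g : Euc n → Euc N}
    (hu : u ∈ dirichletClass Ω k g) (hv : v ∈ dirichletClass Ω k g) {a b : ℝ} (ha : 0 ≤ a)
    (hb : 0 ≤ b) (hab : a + b = 1) : a • u + b • v ∈ dirichletClass Ω k g := by
  refine ⟨hu.1.linComb hv.1 a b, ?_⟩
  have e : a • u + b • v - g = a • (u - g) + b • (v - g) := by
    -- The weights sum to 1, so the boundary datum splits along with the combination.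
    have : g = a • g + b • g := by rw [← add_smul, hab, one_smul]
    nth_rw 1 [this]
    simp only [smul_sub]
    abel
  rw [e]
  exact hu.2.convexComb hΩ hv.2 ha hb hab

lemma obstacleSet_convexComb {ψ : Euc n → Euc N} (hu : u ∈ obstacleSet Ω ψ)
    (hv : v ∈ obstacleSet Ω ψ) {a b : ℝ} (ha : 0 ≤ a) (hb : 0 ≤ b) (hab : a + b = 1) :
    a • u + b • v ∈ obstacleSet Ω ψ := by
  refine ⟨(hu.1.smul a).add (hv.1.smul b), ?_⟩
  filter_upwards [hu.2, hv.2] with x h1 h2 i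
  have e : ψ x i = a * ψ x i + b * ψ x i := by rw [← add_mul, hab, one_mul]
  rw [e]
  exact add_le_add (mul_le_mul_of_nonneg_left (h1 i) ha) (mul_le_mul_of_nonneg_left (h2 i) hb)

end WeakGradients

/-! ### Extended real-valued integrands -/

lemma HasSuperlinearBound.nonneg {M : Type*} [NormedAddCommGroup M] {F : M → EReal}
    (hF : HasSuperlinearBound F) (ξ : M) : 0 ≤ F ξ := by
  obtain ⟨θ, h0, -, -, -, hθ⟩ := hF
  exact (EReal.coe_nonneg.2 (h0 _ (norm_nonneg ξ))).trans (hθ ξ)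

section Integrands

variable {M : Type*} [NormedAddCommGroup M] [InnerProductSpace ℝ M] {F : M → EReal}

/-- Nonnegativity excludes the value `⊥`, so the convexity inequality between finite endpoints
descends to real numbers. -/
lemma IsConvexIntegrand.finite_and_toReal_le (hF : IsConvexIntegrand F) (h0 : ∀ ξ, 0 ≤ F ξ)
    {ξ η : M} (hξ : F ξ ≠ ⊤) (hη : F η ≠ ⊤) {a b : ℝ} (ha : 0 ≤ a) (hb : 0 ≤ b)
    (hab : a + b = 1) :
    F (a • ξ + b • η) ≠ ⊤ ∧
      (F (a • ξ + b • η)).toReal ≤ a * (F ξ).toReal + b * (F η).toReal := by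
  have hbot : ∀ ζ, F ζ ≠ ⊥ := fun ζ h => by simpa [h] using h0 ζ
  have h := hF ξ η a b ha hb hab
  rw [← EReal.coe_toReal hξ (hbot ξ), ← EReal.coe_toReal hη (hbot η), ← EReal.coe_mul,
    ← EReal.coe_mul, ← EReal.coe_add] at h
  have hfin : F (a • ξ + b • η) ≠ ⊤ := (h.trans_lt (EReal.coe_lt_top _)).ne
  refine ⟨hfin, ?_⟩
  rw [← EReal.coe_toReal hfin (hbot _)] at h
  exact EReal.coe_le_coe_iff.1 h

/-- The difference quotients of an essentially smooth integrand converge to the directional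
derivative given by its gradient. -/
lemma IsEssentiallySmooth.tendsto_quotient [CompleteSpace M] (hF : IsEssentiallySmooth F) {ξ : M}
    (hξ : F ξ ≠ ⊤) (ζ : M) :
    Tendsto (fun m : ℕ => ((m : ℝ) + 1) *
      ((F (ξ + ((m : ℝ) + 1)⁻¹ • ζ)).toReal - (F ξ).toReal)) atTop
      (𝓝 (inner ℝ (gradF F ξ) ζ)) := by
  -- The domain is open, so it is a neighbourhood of `ξ`, and C¹ regularity on it gives
  -- differentiability at `ξ`.
  have hd : DifferentiableAt ℝ (fun ζ => (F ζ).toReal) ξ :=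
    (hF.2.2.1.contDiffAt (hF.2.1.mem_nhds (lt_top_iff_ne_top.2 hξ))).differentiableAt (by simp)
  have h := hd.hasGradientAt.hasFDerivAt.lim ζ (c := fun m : ℕ => (m : ℝ) + 1) (l := atTop) (by
    refine tendsto_norm_atTop_atTop.comp ?_
    exact tendsto_atTop_add_const_right _ _ tendsto_natCast_atTop_atTop)
  simpa [gradF] using h

end Integrands

/-! ### Comparison and limits of integrals. -/

lemma integral_toReal_le_of_lintegral_le {α : Type*} [MeasurableSpace α] {μ : Measure α}
    {f g : α → ℝ} (hf : Integrable f μ) (hg : Integrable g μ) (hf0 : 0 ≤ᵐ[μ] f) (hg0 : 0 ≤ᵐ[μ] g)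
    (h : ∫⁻ x, ENNReal.ofReal (f x) ∂μ ≤ ∫⁻ x, ENNReal.ofReal (g x) ∂μ) :
    ∫ x, f x ∂μ ≤ ∫ x, g x ∂μ := by
  rw [← ofReal_integral_eq_lintegral_ofReal hf hf0,
    ← ofReal_integral_eq_lintegral_ofReal hg hg0] at h
  exact (ENNReal.ofReal_le_ofReal_iff (integral_nonneg_of_ae hg0)).1 h

/-- A limit of functions that are bounded above by an integrable function and have nonnegative
integrals is integrable with nonnegative integral. -/
lemma integrable_and_integral_nonneg_of_tendsto {α : Type*} [MeasurableSpace α] {μ : Measure α}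
    {f : ℕ → α → ℝ} {D p : α → ℝ} (hD : Integrable D μ) (hf : ∀ m, Integrable (f m) μ)
    (hfD : ∀ m, ∀ᵐ x ∂μ, f m x ≤ D x) (hf0 : ∀ m, 0 ≤ ∫ x, f m x ∂μ)
    (hlim : ∀ᵐ x ∂μ, Tendsto (fun m => f m x) atTop (𝓝 (p x))) :
    Integrable p μ ∧ 0 ≤ ∫ x, p x ∂μ := by
  have hpm : AEStronglyMeasurable p μ :=
    aestronglyMeasurable_of_tendsto_ae atTop (fun m => (hf m).aestronglyMeasurable) hlim
  have hpD : 0 ≤ᵐ[μ] fun x => D x - p x := by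
    filter_upwards [hlim, ae_all_iff.2 hfD] with x h1 h2
    exact sub_nonneg.2 (le_of_tendsto' h1 h2)
  -- Needed because `ENNReal.ofReal` truncates at 0: it lets the bound below be read as one between
  -- reals.
  have hD0 : 0 ≤ ∫ x, D x ∂μ := (hf0 0).trans (integral_mono_ae (hf 0) hD (hfD 0))
  -- Fatou for `D - f m ≥ 0`, whose integrals are at most `∫ D` since `∫ f m ≥ 0`.
  have hbound : ∫⁻ x, ENNReal.ofReal (D x - p x) ∂μ ≤ ENNReal.ofReal (∫ x, D x ∂μ) := by
    calc ∫⁻ x, ENNReal.ofReal (D x - p x) ∂μ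
        = ∫⁻ x, liminf (fun m => ENNReal.ofReal (D x - f m x)) atTop ∂μ := by
          refine lintegral_congr_ae ?_
          filter_upwards [hlim] with x hx
          exact ((ENNReal.tendsto_ofReal (hx.const_sub (D x))).liminf_eq).symm
      _ ≤ liminf (fun m => ∫⁻ x, ENNReal.ofReal (D x - f m x) ∂μ) atTop :=
          lintegral_liminf_le' fun m => (hD.sub (hf m)).aemeasurable.ennreal_ofReal
      _ ≤ liminf (fun _ : ℕ => ENNReal.ofReal (∫ x, D x ∂μ)) atTop := by
          refine liminf_le_liminf (Eventually.of_forall fun m => ?_)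
          have hi : Integrable (fun x => D x - f m x) μ := hD.sub (hf m)
          rw [← ofReal_integral_eq_lintegral_ofReal hi
            ((hfD m).mono fun x hx => sub_nonneg.2 hx), integral_sub hD (hf m)]
          exact ENNReal.ofReal_le_ofReal (by linarith [hf0 m])
      _ = _ := by simp
  have hi : Integrable (fun x => D x - p x) μ := by
    refine ⟨hD.aestronglyMeasurable.sub hpm, ?_⟩
    rw [hasFiniteIntegral_iff_ofReal hpD]
    exact hbound.trans_lt ENNReal.ofReal_lt_top
  have hp : Integrable p μ := (hD.sub hi).congr (ae_of_all _ fun x => by simp)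
  refine ⟨hp, ?_⟩
  rw [← ofReal_integral_eq_lintegral_ofReal hi hpD, ENNReal.ofReal_le_ofReal_iff hD0,
    integral_sub hD hp] at hbound
  linarith

/-- The energy as an integral of real values, where the integrand is finite. -/
lemma energy_eq_lintegral_ofReal {n N k : ℕ} {Ω : Set (Euc n)} {F : SymTensor N k n → EReal}
    {w : Euc n → Euc N} {A : Euc n → SymTensor N k n} (h : weakGrad Ω k w =ᵐ[volume.restrict Ω] A)
    (hA : ∀ᵐ x ∂(volume.restrict Ω), F (A x) ≠ ⊤) :
    energy Ω k F w = ∫⁻ x in Ω, ENNReal.ofReal (F (A x)).toReal := by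
  refine lintegral_congr_ae ?_
  filter_upwards [h, hA] with x hx h1
  rw [hx, EReal.toENNReal_of_ne_top h1]

/-! ### The variational inequality. -/

theorem mainTheorem4
    (n N k : ℕ) (hn : 1 ≤ n) (hN : 1 ≤ N) (hk : 1 ≤ k)
    (Ω : Set (Euc n)) (hΩo : IsOpen Ω) (hΩb : Bornology.IsBounded Ω)
    (hΩe : IsW11ExtensionDomain Ω)
    (F : SymTensor N k n → EReal)
    (hFconv : IsConvexIntegrand F) (hFlsc : LowerSemicontinuous F)
    (hFprop : IsProperIntegrand F) (hFsmooth : IsEssentiallySmooth F)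
    (hFsuper : HasSuperlinearBound F)
    (ψ : Euc n → Euc N) (hψ : MemSobolev Ω k ψ)
    (hψp : InL1 Ω (fun x => F (weakGrad Ω k ψ x)))
    (hψm : InL1 Ω (fun x => F (-weakGrad Ω k ψ x)))
    (g : Euc n → Euc N) (hg : MemSobolev Ω k g) (hgK : g ∈ obstacleSet Ω ψ)
    (s : ℝ) (hs : 1 < s) (hgs : InL1 Ω (fun x => F (s • weakGrad Ω k g x)))
    (u : Euc n → Euc N) (hu : IsMinimiser Ω k F g (obstacleSet Ω ψ) u)
    (v : Euc n → Euc N) (hv : v ∈ dirichletClass Ω k g ∩ obstacleSet Ω ψ)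
    (hvp : InL1 Ω (fun x => F (weakGrad Ω k v x)))
    (hvm : InL1 Ω (fun x => F (-weakGrad Ω k v x))) :
    IntegrableOn
        (fun x => inner ℝ (gradF F (weakGrad Ω k u x)) (weakGrad Ω k (v - u) x)) Ω ∧
      0 ≤ ∫ x in Ω, inner ℝ (gradF F (weakGrad Ω k u x)) (weakGrad Ω k (v - u) x) := by
  obtain ⟨⟨huD, huK⟩, huL, hmin⟩ := hu
  obtain ⟨hvD, hvK⟩ := hv
  have h0 := hFsuper.nonneg
  set U := weakGrad Ω k u with hU
  set V := weakGrad Ω k v with hV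
  -- The shift by 1 keeps `t m` in (0, 1], so every competitor is a convex combination of `u` and
  -- `v`.
  set t : ℕ → ℝ := fun m => ((m : ℝ) + 1)⁻¹ with ht
  have t0 : ∀ m, 0 < t m := fun m => by positivity
  have t1 : ∀ m, 0 ≤ 1 - t m := fun m =>
    sub_nonneg.2 (inv_le_one_of_one_le₀ (by simp))
  have tinv : ∀ m : ℕ, ((m : ℝ) + 1) * t m = 1 := fun m => mul_inv_cancel₀ (by positivity)
  set A : ℕ → Euc n → SymTensor N k n := fun m => (1 - t m) • U + t m • V with hA
  have hAx : ∀ m x, A m x = U x + t m • (V x - U x) := fun m x => by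
    simp only [hA, Pi.add_apply, Pi.smul_apply]
    module
  have conv : ∀ m, ∀ᵐ x ∂(volume.restrict Ω), F (A m x) ≠ ⊤ ∧
      (F (A m x)).toReal ≤ (1 - t m) * (F (U x)).toReal + t m * (F (V x)).toReal := fun m => by
    filter_upwards [huL.1, hvp.1] with x h1 h2
    exact hFconv.finite_and_toReal_le h0 h1.1 h2.1 (t1 m) (t0 m).le (by ring)
  have iU : IntegrableOn U Ω := huD.1.integrableOn_weakGrad hΩo le_rfl
  have iV : IntegrableOn V Ω := hvD.1.integrableOn_weakGrad hΩo le_rfl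
  -- Lower semicontinuity gives measurability; convexity gives the integrable majorant.
  have iE : ∀ m, Integrable (fun x => (F (A m x)).toReal) (volume.restrict Ω) := fun m => by
    refine Integrable.mono' ((huL.2.const_mul (1 - t m)).add (hvp.2.const_mul (t m))) ?_ ?_
    · have hm : AEMeasurable (A m) (volume.restrict Ω) :=
        ((iU.smul (1 - t m)).add (iV.smul (t m))).aestronglyMeasurable.aemeasurable
      exact (hFlsc.measurable.comp_aemeasurable hm).ereal_toReal.aestronglyMeasurable
    · filter_upwards [conv m] with x hx
      rw [Real.norm_of_nonneg (EReal.toReal_nonneg (h0 _))]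
      exact hx.2
  have hmin' : ∀ m, ∫ x in Ω, (F (U x)).toReal ≤ ∫ x in Ω, (F (A m x)).toReal := fun m => by
    have hab : 1 - t m + t m = 1 := by ring
    have h := hmin ((1 - t m) • u + t m • v)
      ⟨dirichletClass_convexComb hΩo huD hvD (t1 m) (t0 m).le hab,
        obstacleSet_convexComb huK hvK (t1 m) (t0 m).le hab⟩
    rw [energy_eq_lintegral_ofReal (ae_eq_refl _) (huL.1.mono fun x hx => hx.1),
      energy_eq_lintegral_ofReal (huD.1.weakGrad_linComb hΩo hvD.1 le_rfl _ _)
        ((conv m).mono fun x hx => hx.1)] at h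
    exact integral_toReal_le_of_lintegral_le huL.2 (iE m)
      (Eventually.of_forall fun x => EReal.toReal_nonneg (h0 _))
      (Eventually.of_forall fun x => EReal.toReal_nonneg (h0 _)) h
  have hVU : weakGrad Ω k (v - u) =ᵐ[volume.restrict Ω] V - U := by
    have h := hvD.1.weakGrad_linComb hΩo huD.1 le_rfl 1 (-1)
    simpa [← sub_eq_add_neg] using h
  refine integrable_and_integral_nonneg_of_tendsto
    (D := fun x => (F (V x)).toReal - (F (U x)).toReal)
    (f := fun m x => ((m : ℝ) + 1) * ((F (A m x)).toReal - (F (U x)).toReal))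
    (hvp.2.sub huL.2) (fun m => ((iE m).sub huL.2).const_mul _) (fun m => ?_) (fun m => ?_) ?_
  -- Convexity bounds the increment by `t m` times `F(V) - F(U)`, and the factor `m + 1` cancels `t
  -- m`.
  · filter_upwards [conv m] with x hx
    calc _ ≤ ((m : ℝ) + 1) * (t m * ((F (V x)).toReal - (F (U x)).toReal)) :=
          mul_le_mul_of_nonneg_left (by linarith [hx.2]) (by positivity)
      _ = _ := by rw [← mul_assoc, tinv, one_mul]
  · rw [integral_const_mul, integral_sub (iE m) huL.2]
    exact mul_nonneg (by positivity) (sub_nonneg.2 (hmin' m))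
  · filter_upwards [huL.1, hVU] with x h1 h2
    rw [h2]
    simp only [hAx]
    exact hFsmooth.tendsto_quotient h1.1 _
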